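/- Let $X$ be a countably infinite set, $m:X\to(0,\infty)$, and $m(A)=\sum_{x\in A}m(x)\in[0,\infty]$ for $A\subseteq X$. Let $b:X\times X\to[0,\infty)$ be symmetric with $b(x,x)=0$ and $\sum_{y}b(x,y)<\infty$ for all $x\in X$; write $x\sim y$ if $b(x,y)>0$, and assume that every vertex has a neighbor. Let $d:X\times X\to[0,\infty)$ be an intrinsic metric, that is, a pseudo metric with $\sum_{y\in X}b(x,y)d(x,y)^2\le m(x)$ for all $x\in X$. For $u:X\to\mathbb R$ let $Q(u)=\frac12\sum_{x,y\in X}b(x,y)(u(x)-u(y))^2\in[0,\infty]$ and $\|u\|^2=\sum_{x\in X}u(x)^2m(x)$. Let $D^{\max}=\{u:X\to\mathbb R\mid \|u\|^2<\infty,\ Q(u)<\infty\}$ be the maximal form domain, and let the form domain $D$ be the closure in $D^{\max}$ of the finitely supported functions with respect to the norm $\|u\|_Q=(Q(u)+\|u\|^2)^{1/2}$. Let $$\alpha=\inf_{\emptyset\ne W\subseteq X\text{ finite}}\frac{1}{m(W)}\sum_{x\in W,\,y\in X\setminus W}b(x,y)d(x,y)$$ be the isoperimetric constant and, with $B_r(x)=\{y\in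 X\mid d(x,y)\le r\}$, let $$\mu=\liminf_{r\to\infty}\inf_{x}\frac1r\log\frac{m(B_r(x))}{m(B_1(x))}\in[0,\infty]$$ be the exponential volume growth, where the infimum is over all $x\in X$ with $m(B_1(x))<\infty$ (with $\inf\emptyset=\infty$ and $\log\infty=\infty$). If $D=D^{\max}$, then $2\alpha\le\mu$. Moreover, $D=D^{\max}$ holds (and hence $2\alpha\le\mu$) if one of the following conditions is satisfied: (a) $b$ is locally finite (every vertex has only finitely many neighbors), $d$ is a path metric (there are symmetric weights $w$ with $w(x,y)>0$ for $x\sim y$ such that $d(x,y)$ is the infimum of $\sum_{i=1}^{k}w(x_{i-1},x_i)$ over all finite sequences $x=x_0\sim x_1\sim\dots\sim x_k=y$ with $k\ge0$), and $(X,d)$ is complete. (b) Every infinite path has infinite measure: $\sum_{k}m(x_k)=\infty$ for every sequence $(x_k)_{k\ge0}$ of pairwise distinct vertices with $x_k\sim x_{k+1}$ for all $k$. -/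

import Mathlib

open scoped ENNReal

/-- A graph over a discrete space `X`: a symmetric edge weight `b : X × X → [0, ∞)` with zero
diagonal, summable at every vertex, and without isolated vertices. -/
structure WGraph (X : Type*) where
  b : X → X → ℝ
  nonneg : ∀ x y, 0 ≤ b x y
  symm : ∀ x y, b x y = b y x
  diag : ∀ x, b x x = 0
  summable : ∀ x, Summable (b x)
  exists_neighbor : ∀ x, ∃ y, 0 < b x y

namespace WGraph

variable {X : Type*}

/-- The neighborhood relation `x ∼ y`, that is `b x y > 0`. -/
def graph (G : WGraph X) : SimpleGraph X where
  Adj x y := 0 < G.b x y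
  symm := ⟨fun x y h => by rw [G.symm y x]; exact h⟩
  loopless := ⟨fun x h => by rw [G.diag x] at h; exact lt_irrefl _ h⟩

/-- Every vertex has only finitely many neighbors. -/
def IsLocallyFinite (G : WGraph X) : Prop :=
  ∀ x, {y | G.graph.Adj x y}.Finite

/-- The measure `m(A) = ∑_{x ∈ A} m(x)`, with values in `[0, ∞]`. -/
noncomputable def vol (m : X → ℝ) (A : Set X) : ℝ≥0∞ :=
  ∑' x : A, ENNReal.ofReal (m x)

/-- The energy `Q(u) = 1/2 ∑_{x,y} b(x,y) (u(x) - u(y))²`, with values in `[0, ∞]`. -/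
noncomputable def energy (G : WGraph X) (u : X → ℝ) : ℝ≥0∞ :=
  (∑' x, ∑' y, ENNReal.ofReal (G.b x y * (u x - u y) ^ 2)) / 2

/-- The squared norm `‖u‖² = ∑_x u(x)² m(x)` of `ℓ²(X, m)`, with values in `[0, ∞]`. -/
noncomputable def normSq (m : X → ℝ) (u : X → ℝ) : ℝ≥0∞ :=
  ∑' x, ENNReal.ofReal (u x ^ 2 * m x)

/-- The maximal form domain: the functions in `ℓ²(X, m)` of finite energy. -/
def maxFormDomain (G : WGraph X) (m : X → ℝ) : Set (X → ℝ) :=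
  {u | normSq m u < ⊤ ∧ G.energy u < ⊤}

/-- The form domain `D`: the closure of the finitely supported functions (the functions of
compact support for the discrete topology) with respect to `‖u‖_Q = (Q(u) + ‖u‖²)^(1/2)`,
taken inside the space of functions in `ℓ²(X, m)` of finite energy. -/
def formDomain (G : WGraph X) (m : X → ℝ) : Set (X → ℝ) :=
  {u | u ∈ G.maxFormDomain m ∧ ∀ ε : ℝ≥0∞, 0 < ε → ∃ φ : X → ℝ, (Function.support φ).Finite ∧
    G.energy (u - φ) + normSq m (u - φ) < ε}

/-- Every infinite path (of pairwise distinct, successively adjacent vertices) has infinite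
measure. -/
def InfinitePathsHaveInfiniteMeasure (G : WGraph X) (m : X → ℝ) : Prop :=
  ∀ p : ℕ → X, Function.Injective p → (∀ k, G.graph.Adj (p k) (p (k + 1))) →
    vol m (Set.range p) = ⊤

/-- The length of a walk with respect to edge weights `w`. -/
def walkLength (G : WGraph X) (w : X → X → ℝ) {x y : X} (p : G.graph.Walk x y) : ℝ :=
  (p.darts.map fun e => w e.fst e.snd).sum

variable [PseudoMetricSpace X]

/-- The pseudo metric is intrinsic: `∑_y b(x,y) d(x,y)² ≤ m(x)` for all `x`. -/
def IsIntrinsic (G : WGraph X) (m : X → ℝ) : Prop :=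
  ∀ x, ∑' y, ENNReal.ofReal (G.b x y * dist x y ^ 2) ≤ ENNReal.ofReal (m x)

/-- The pseudo metric is the path metric induced by some symmetric weights which are positive on
the edges: the distance of two vertices is the infimum of the lengths of the walks that join
them. (`IsGLB` in `ℝ` requires that such walks exist.) -/
def IsPathMetric (G : WGraph X) : Prop :=
  ∃ w : X → X → ℝ, (∀ x y, w x y = w y x) ∧ (∀ x y, G.graph.Adj x y → 0 < w x y) ∧
    ∀ x y, IsGLB (Set.range fun p : G.graph.Walk x y => G.walkLength w p) (dist x y)

/-- The measure `|∂W| = ∑_{x ∈ W, y ∉ W} b(x,y) d(x,y)` of the boundary of `W`. Pairs with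
`b(x,y) = 0` contribute nothing. -/
noncomputable def boundaryMeasure (G : WGraph X) (W : Set X) : ℝ≥0∞ :=
  ∑' x : W, ∑' y : (Wᶜ : Set X), ENNReal.ofReal (G.b x y * dist (x : X) (y : X))

/-- The isoperimetric (Cheeger) constant `α = inf |∂W| / m(W)` over the nonempty finite sets. -/
noncomputable def cheegerConst (G : WGraph X) (m : X → ℝ) : ℝ≥0∞ :=
  ⨅ (W : Finset X) (_ : W.Nonempty), G.boundaryMeasure (W : Set X) / vol m (W : Set X)

/-- The exponential volume growth
`μ = liminf_{r → ∞} inf_x (1/r) log (m(B_r(x)) / m(B_1(x)))` with values in `[-∞, ∞]`. The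
infimum runs over those `x` for which `m(B_1(x))` is finite, so that the quotient makes sense. -/
noncomputable def volumeGrowth (m : X → ℝ) : EReal :=
  Filter.liminf (fun r : ℝ => ⨅ (x : X) (_ : vol m (Metric.closedBall x 1) ≠ ⊤),
    ENNReal.log (vol m (Metric.closedBall x r) / vol m (Metric.closedBall x 1)) / (r : EReal))
    Filter.atTop

end WGraph

/-!
The bound `2 α ≤ μ` compares a lower and an upper estimate of Rayleigh quotients `Q(u) / ‖u‖²`.

The lower estimate is Cheeger's inequality `α² / 2 * ‖u‖² ≤ Q(u)`. For finitely supported `u` it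
follows from the co-area formula (`lintegral_boundaryMeasure`), applied to `u²`, and Young's
inequality, where the intrinsic metric absorbs the factor `d(x, y)`. It passes to the closure `D`
(`IsIntrinsic.cheeger_inequality`).

The upper estimate uses the test functions `(exp (a (R - d(o, ·))) - 1)₊`, whose energy is at most
`a² / 2` times their squared norm, up to a multiple of `m(B_R(o))`. They belong to the maximal form
domain as soon as `m(B_R(o))` is finite. If `D` is maximal and `a < α`, Cheeger's inequality
therefore bounds their squared norm, and so `exp(2 a R) m(B_1(o))`, by a constant multiple of
`m(B_R(o))`, uniformly in `o` and `R` (`IsIntrinsic.exists_le_mul_vol_closedBall`). Hence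
`2 a ≤ μ` for all `a < α`.

The two criteria for `D` to be maximal are independent of this. For a complete path metric on a
locally finite graph all balls are finite: an infinite ball would produce a path of finite length,
which converges by completeness, although all points are isolated (`finite_ball_of_isPathMetric`).
Cutoff functions with small Lipschitz constant then approximate every function
(`IsIntrinsic.formDomain_eq_of_finite_ball`). If infinite paths have infinite measure, the maximal
form domain is embedded into `ℓ²(X ⊕ X × X)`. A function `w` that is orthogonal to all finitely
supported ones satisfies a maximum principle: where it is positive, it is larger at some neighbor
(`exists_adj_lt_of_mem_orthogonal`). So it would increase along an infinite path, against
`‖w‖ < ∞`, and `w = 0` (`formDomain_eq_of_infinitePaths`).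
-/

/-! ### The co-area formula and Cheeger's inequality -/

namespace WGraph

variable {X : Type*}

theorem two_mul_energy (G : WGraph X) (u : X → ℝ) :
    2 * G.energy u = ∑' x, ∑' y, ENNReal.ofReal (G.b x y * (u x - u y) ^ 2) :=
  ENNReal.mul_div_cancel two_ne_zero ENNReal.ofNat_ne_top

theorem vol_eq_tsum_indicator (m : X → ℝ) (A : Set X) :
    vol m A = ∑' x, A.indicator (fun x => ENNReal.ofReal (m x)) x :=
  tsum_subtype A fun x => ENNReal.ofReal (m x)

theorem normSq_ne_top_of_finite (m : X → ℝ) {φ : X → ℝ} (hφ : (Function.support φ).Finite) :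
    normSq m φ ≠ ⊤ := by
  rw [normSq, tsum_eq_sum (s := hφ.toFinset) (fun x hx => by simp at hx; simp [hx])]
  exact ENNReal.sum_ne_top.2 fun x _ => ENNReal.ofReal_ne_top

/-- Young's inequality `(p + q)² ≤ (1 + δ) p² + (1 + δ⁻¹) q²`, with a weight `k`. -/
theorem ofReal_mul_add_sq_le {k δ : ℝ} (hk : 0 ≤ k) (hδ : 0 < δ) (p q : ℝ) :
    ENNReal.ofReal (k * (p + q) ^ 2) ≤ ENNReal.ofReal (1 + δ) * ENNReal.ofReal (k * p ^ 2)
      + ENNReal.ofReal (1 + δ⁻¹) * ENNReal.ofReal (k * q ^ 2) := by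
  rw [← ENNReal.ofReal_mul (by positivity), ← ENNReal.ofReal_mul (by positivity),
    ← ENNReal.ofReal_add (by positivity) (by positivity)]
  refine ENNReal.ofReal_le_ofReal ?_
  have : (1 + δ) * (k * p ^ 2) + (1 + δ⁻¹) * (k * q ^ 2) - k * (p + q) ^ 2
      = k * δ⁻¹ * (δ * p - q) ^ 2 := by field_simp; ring
  have h2 : 0 ≤ k * δ⁻¹ * (δ * p - q) ^ 2 := by positivity
  linarith

theorem energy_add_le (G : WGraph X) {δ : ℝ} (hδ : 0 < δ) (u v : X → ℝ) :
    G.energy (u + v) ≤ ENNReal.ofReal (1 + δ) * G.energy u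
      + ENNReal.ofReal (1 + δ⁻¹) * G.energy v := by
  rw [energy, energy, energy, ← mul_div_assoc, ← mul_div_assoc, ← ENNReal.add_div]
  gcongr
  simp_rw [← ENNReal.tsum_mul_left, ← ENNReal.tsum_add]
  refine ENNReal.tsum_le_tsum fun x => ENNReal.tsum_le_tsum fun y => ?_
  refine le_trans (le_of_eq ?_) (ofReal_mul_add_sq_le (G.nonneg x y) hδ _ _)
  simp only [Pi.add_apply]; ring_nf

theorem normSq_add_le {m : X → ℝ} (hm : ∀ x, 0 < m x) {δ : ℝ} (hδ : 0 < δ) (u v : X → ℝ) :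
    normSq m (u + v) ≤ ENNReal.ofReal (1 + δ) * normSq m u
      + ENNReal.ofReal (1 + δ⁻¹) * normSq m v := by
  simp_rw [normSq, ← ENNReal.tsum_mul_left, ← ENNReal.tsum_add]
  refine ENNReal.tsum_le_tsum fun x => ?_
  simpa only [Pi.add_apply, mul_comm] using ofReal_mul_add_sq_le (hm x).le hδ (u x) (v x)

variable [PseudoMetricSpace X]

theorem boundaryMeasure_eq_tsum_indicator (G : WGraph X) (W : Set X) :
    G.boundaryMeasure W = ∑' x, W.indicator (fun x => ∑' y, Wᶜ.indicator
      (fun y => ENNReal.ofReal (G.b x y * dist x y)) y) x := by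
  rw [← tsum_subtype W]
  exact tsum_congr fun x => tsum_subtype Wᶜ fun y => ENNReal.ofReal (G.b x y * dist (x : X) y)

theorem cheegerConst_mul_vol_le (G : WGraph X) (m : X → ℝ) {W : Set X} (hW : W.Finite) :
    G.cheegerConst m * vol m W ≤ G.boundaryMeasure W := by
  rcases W.eq_empty_or_nonempty with rfl | hne
  · simp [vol]
  · refine ENNReal.mul_le_of_le_div ?_
    have h := iInf₂_le (f := fun (W : Finset X) (_ : W.Nonempty) =>
      G.boundaryMeasure (W : Set X) / vol m (W : Set X)) hW.toFinset (by simpa using hne)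
    simpa [cheegerConst] using h

/-- An intrinsic metric turns a sum over edges weighted by `b d²` into a sum over vertices. -/
theorem IsIntrinsic.tsum_mul_left_le {G : WGraph X} {m : X → ℝ} (hd : G.IsIntrinsic m)
    {v : X → ℝ} (hv : ∀ x, 0 ≤ v x) :
    ∑' x, ∑' y, ENNReal.ofReal (G.b x y * dist x y ^ 2 * v x)
      ≤ ∑' x, ENNReal.ofReal (v x * m x) := by
  refine ENNReal.tsum_le_tsum fun x => ?_
  simp_rw [ENNReal.ofReal_mul' (hv x)]
  rw [ENNReal.tsum_mul_right, ENNReal.ofReal_mul (hv x), mul_comm]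
  gcongr
  exact hd x

theorem IsIntrinsic.tsum_mul_right_le {G : WGraph X} {m : X → ℝ} (hd : G.IsIntrinsic m)
    {v : X → ℝ} (hv : ∀ x, 0 ≤ v x) :
    ∑' x, ∑' y, ENNReal.ofReal (G.b x y * dist x y ^ 2 * v y)
      ≤ ∑' x, ENNReal.ofReal (v x * m x) := by
  rw [ENNReal.tsum_comm]
  refine le_trans (le_of_eq ?_) (hd.tsum_mul_left_le hv)
  refine tsum_congr fun x => tsum_congr fun y => ?_
  rw [G.symm, dist_comm]

theorem IsIntrinsic.tsum_mul_add_le {G : WGraph X} {m : X → ℝ} (hd : G.IsIntrinsic m)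
    {v : X → ℝ} (hv : ∀ x, 0 ≤ v x) :
    ∑' x, ∑' y, ENNReal.ofReal (G.b x y * dist x y ^ 2 * (v x + v y))
      ≤ 2 * ∑' x, ENNReal.ofReal (v x * m x) := by
  have hb : ∀ x y, 0 ≤ G.b x y * dist x y ^ 2 := fun x y => mul_nonneg (G.nonneg x y) (sq_nonneg _)
  simp_rw [mul_add, ENNReal.ofReal_add (mul_nonneg (hb _ _) (hv _)) (mul_nonneg (hb _ _) (hv _)),
    ENNReal.tsum_add]
  rw [two_mul]
  exact add_le_add (hd.tsum_mul_left_le hv) (hd.tsum_mul_right_le hv)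

open MeasureTheory in
/-- Co-area formula: the boundary measures of the superlevel sets of `u` integrate to the
`ℓ¹`-energy of `u`. -/
theorem lintegral_boundaryMeasure [Countable X] (G : WGraph X) (u : X → ℝ) :
    ∫⁻ t : ℝ, G.boundaryMeasure {x | t < u x}
      = ∑' x, ∑' y, ENNReal.ofReal (G.b x y * dist x y) * ENNReal.ofReal (u x - u y) := by
  have key : ∀ t : ℝ, G.boundaryMeasure {x | t < u x}
      = ∑' x, ∑' y, (Set.Ico (u y) (u x)).indicator
          (fun _ => ENNReal.ofReal (G.b x y * dist x y)) t := by
    intro t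
    rw [boundaryMeasure_eq_tsum_indicator]
    refine tsum_congr fun x => ?_
    by_cases hx : t < u x
    · rw [Set.indicator_of_mem (by exact hx)]
      refine tsum_congr fun y => ?_
      by_cases hy : u y ≤ t <;> simp [hx, hy, not_lt.2, not_le.1]
    · simp [Set.indicator_apply, hx]
  have meas : ∀ x y, Measurable ((Set.Ico (u y) (u x)).indicator
      (fun _ => ENNReal.ofReal (G.b x y * dist x y))) :=
    fun x y => measurable_const.indicator measurableSet_Ico
  simp_rw [key]
  rw [lintegral_tsum fun x => (Measurable.tsum (meas x)).aemeasurable]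
  refine tsum_congr fun x => ?_
  rw [lintegral_tsum fun y => (meas x y).aemeasurable]
  refine tsum_congr fun y => ?_
  rw [lintegral_indicator_const measurableSet_Ico, Real.volume_Ico]

open MeasureTheory in
/-- The isoperimetric constant controls the `ℓ¹`-norm of a finitely supported function by its
`ℓ¹`-energy. -/
theorem cheegerConst_mul_tsum_le [Countable X] (G : WGraph X) (m : X → ℝ) {u : X → ℝ}
    (hfin : (Function.support u).Finite) :
    G.cheegerConst m * ∑' x, ENNReal.ofReal (m x) * ENNReal.ofReal (u x)
      ≤ ∑' x, ∑' y, ENNReal.ofReal (G.b x y * dist x y) * ENNReal.ofReal (u x - u y) := by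
  have meas : ∀ x, Measurable ((Set.Ico 0 (u x)).indicator (fun _ => ENNReal.ofReal (m x))) :=
    fun x => measurable_const.indicator measurableSet_Ico
  have h1 : ∑' x, ENNReal.ofReal (m x) * ENNReal.ofReal (u x)
      = ∫⁻ t : ℝ, ∑' x, (Set.Ico 0 (u x)).indicator (fun _ => ENNReal.ofReal (m x)) t := by
    rw [lintegral_tsum fun x => (meas x).aemeasurable]
    refine tsum_congr fun x => ?_
    rw [lintegral_indicator_const measurableSet_Ico, Real.volume_Ico, sub_zero]
  rw [h1, ← lintegral_boundaryMeasure,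
    ← lintegral_const_mul _ (Measurable.tsum meas)]
  refine lintegral_mono fun t => ?_
  rcases lt_or_ge t 0 with ht | ht
  · simp [not_le.2 ht]
  · have hsub : {x | t < u x} ⊆ Function.support u := fun x hx => (ht.trans_lt hx).ne'
    refine le_trans (le_of_eq ?_) (G.cheegerConst_mul_vol_le m (hfin.subset hsub))
    rw [vol_eq_tsum_indicator]
    congr 1
    refine tsum_congr fun x => ?_
    simp [Set.indicator_apply, ht]

/-- Cheeger's inequality for finitely supported functions: the bottom of the spectrum is at least
`α² / 2`. -/
theorem IsIntrinsic.cheeger_inequality_of_finite [Countable X] {G : WGraph X} {m : X → ℝ}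
    (hd : G.IsIntrinsic m) {c : ℝ} (hc : 0 < c)
    (hcα : ENNReal.ofReal c ≤ G.cheegerConst m) {φ : X → ℝ} (hφ : (Function.support φ).Finite) :
    ENNReal.ofReal (c ^ 2 / 2) * normSq m φ ≤ G.energy φ := by
  have hA := G.cheegerConst_mul_tsum_le m (u := fun x => φ x ^ 2)
    (hφ.subset fun x hx h => hx (by simp [h]))
  have hN : ∑' x, ENNReal.ofReal (m x) * ENNReal.ofReal (φ x ^ 2) = normSq m φ := by
    refine tsum_congr fun x => ?_
    rw [mul_comm, ENNReal.ofReal_mul (sq_nonneg _)]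
  set S := ∑' x, ∑' y, ENNReal.ofReal (G.b x y * dist x y) *
    ENNReal.ofReal (φ x ^ 2 - φ y ^ 2) with hS
  have hS' : S = ∑' x, ∑' y, ENNReal.ofReal (G.b x y * dist x y) *
      ENNReal.ofReal (φ y ^ 2 - φ x ^ 2) := by
    rw [hS, ENNReal.tsum_comm]
    refine tsum_congr fun x => tsum_congr fun y => ?_
    rw [G.symm, dist_comm]
  rw [hN] at hA
  have hbd : ∀ x y, 0 ≤ G.b x y * dist x y := fun x y => mul_nonneg (G.nonneg x y) dist_nonneg
  -- Young's inequality; the weight `c / 2` is the one that optimizes the final estimate.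
  have hY : 2 * S ≤ ENNReal.ofReal c⁻¹ * (2 * G.energy φ)
      + ENNReal.ofReal (c / 2) * (2 * normSq m φ) := by
    calc 2 * S = ∑' x, ∑' y, (ENNReal.ofReal (G.b x y * dist x y) *
          ENNReal.ofReal (φ x ^ 2 - φ y ^ 2) + ENNReal.ofReal (G.b x y * dist x y) *
          ENNReal.ofReal (φ y ^ 2 - φ x ^ 2)) := by
          simp_rw [ENNReal.tsum_add]
          rw [← hS, ← hS', two_mul]
      _ ≤ ∑' x, ∑' y, (ENNReal.ofReal c⁻¹ * ENNReal.ofReal (G.b x y * (φ x - φ y) ^ 2)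
          + ENNReal.ofReal (c / 2) *
            ENNReal.ofReal (G.b x y * dist x y ^ 2 * (φ x ^ 2 + φ y ^ 2))) := by
          refine ENNReal.tsum_le_tsum fun x => ENNReal.tsum_le_tsum fun y => ?_
          rw [← mul_add, ← ENNReal.ofReal_mul (by positivity), ← ENNReal.ofReal_mul (by positivity),
            ← ENNReal.ofReal_add (mul_nonneg (by positivity)
              (mul_nonneg (G.nonneg x y) (sq_nonneg _)))
              (mul_nonneg (by positivity) (mul_nonneg (mul_nonneg (G.nonneg x y) (sq_nonneg _))
              (by positivity)))]
          have habs : ENNReal.ofReal (φ x ^ 2 - φ y ^ 2) + ENNReal.ofReal (φ y ^ 2 - φ x ^ 2)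
              = ENNReal.ofReal |φ x ^ 2 - φ y ^ 2| := by
            rcases le_total (φ x ^ 2) (φ y ^ 2) with h | h
            · rw [ENNReal.ofReal_of_nonpos (sub_nonpos.2 h), zero_add, abs_sub_comm,
                abs_of_nonneg (sub_nonneg.2 h)]
            · rw [ENNReal.ofReal_of_nonpos (p := φ y ^ 2 - φ x ^ 2) (sub_nonpos.2 h), add_zero,
                abs_of_nonneg (sub_nonneg.2 h)]
          rw [habs, ← ENNReal.ofReal_mul (hbd x y)]
          refine ENNReal.ofReal_le_ofReal ?_
          have h1 : dist x y * |φ x ^ 2 - φ y ^ 2|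
              ≤ c⁻¹ * (φ x - φ y) ^ 2 + c / 2 * (dist x y ^ 2 * (φ x ^ 2 + φ y ^ 2)) := by
            have e : |φ x ^ 2 - φ y ^ 2| = |φ x - φ y| * |φ x + φ y| := by
              rw [← abs_mul]; ring_nf
            have h2 : dist x y * (|φ x - φ y| * |φ x + φ y|)
                ≤ c⁻¹ * |φ x - φ y| ^ 2 + c / 4 * (dist x y ^ 2 * |φ x + φ y| ^ 2) := by
              have : c⁻¹ * |φ x - φ y| ^ 2 + c / 4 * (dist x y ^ 2 * |φ x + φ y| ^ 2)
                  - dist x y * (|φ x - φ y| * |φ x + φ y|)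
                  = c⁻¹ * (|φ x - φ y| - c / 2 * (dist x y * |φ x + φ y|)) ^ 2 := by
                field_simp; ring
              have h3 : 0 ≤ c⁻¹ * (|φ x - φ y| - c / 2 * (dist x y * |φ x + φ y|)) ^ 2 := by
                positivity
              linarith
            have h4 : c / 4 * (dist x y ^ 2 * |φ x + φ y| ^ 2)
                ≤ c / 4 * (dist x y ^ 2 * (2 * (φ x ^ 2 + φ y ^ 2))) := by
              gcongr
              rw [sq_abs]; nlinarith [sq_nonneg (φ x - φ y)]
            rw [sq_abs] at h2
            rw [e]
            linarith
          nlinarith [mul_le_mul_of_nonneg_left h1 (G.nonneg x y)]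
      _ = ENNReal.ofReal c⁻¹ * (2 * G.energy φ) + ENNReal.ofReal (c / 2) *
          ∑' x, ∑' y, ENNReal.ofReal (G.b x y * dist x y ^ 2 * (φ x ^ 2 + φ y ^ 2)) := by
          simp_rw [ENNReal.tsum_add, ENNReal.tsum_mul_left, two_mul_energy]
      _ ≤ _ := by
          gcongr
          exact hd.tsum_mul_add_le (v := fun x => φ x ^ 2) fun x => sq_nonneg _
  have hfin := normSq_ne_top_of_finite m hφ
  rcases eq_or_ne (G.energy φ) ⊤ with hE | hE
  · simp [hE]
  have hfinal : 2 * (ENNReal.ofReal c * normSq m φ) ≤ ENNReal.ofReal c⁻¹ * (2 * G.energy φ)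
      + ENNReal.ofReal (c / 2) * (2 * normSq m φ) :=
    le_trans (mul_le_mul_right ((mul_le_mul_left hcα _).trans hA) _) hY
  rw [← ENNReal.ofReal_toReal hfin, ← ENNReal.ofReal_toReal hE] at hfinal ⊢
  have hn := ENNReal.toReal_nonneg (a := normSq m φ)
  have hq := ENNReal.toReal_nonneg (a := G.energy φ)
  generalize (normSq m φ).toReal = n at *
  generalize (G.energy φ).toReal = q at *
  rw [show (2 : ℝ≥0∞) = ENNReal.ofReal 2 by simp, ← ENNReal.ofReal_mul hc.le,
    ← ENNReal.ofReal_mul zero_le_two, ← ENNReal.ofReal_mul zero_le_two,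
    ← ENNReal.ofReal_mul zero_le_two, ← ENNReal.ofReal_mul (by positivity),
    ← ENNReal.ofReal_mul (by positivity), ← ENNReal.ofReal_add (by positivity) (by positivity),
    ENNReal.ofReal_le_ofReal_iff (by positivity)] at hfinal
  rw [← ENNReal.ofReal_mul (by positivity)]
  refine ENNReal.ofReal_le_ofReal ?_
  have h5 : c * n ≤ c⁻¹ * (2 * q) := by linarith
  have h6 : c * (c * n) ≤ 2 * q := by
    calc c * (c * n) ≤ c * (c⁻¹ * (2 * q)) := by gcongr
      _ = 2 * q := by field_simp
  linarith

end WGraph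

/-! ### Volume growth from exponential test functions -/

open Filter Topology in
theorem Real.eventually_mul_exp_lt_sq_exp_sub_one {a t K : ℝ} (ha : 0 < a) (ht : t < 2 * a) :
    ∀ᶠ R : ℝ in atTop, K * Real.exp (t * R) < (Real.exp (a * (R - 1)) - 1) ^ 2 := by
  have h1 : Tendsto (fun R : ℝ => Real.exp ((2 * a - t) * R)) atTop atTop :=
    Real.tendsto_exp_atTop.comp (tendsto_id.const_mul_atTop (by linarith))
  filter_upwards [h1.eventually_gt_atTop (4 * K * Real.exp (2 * a)), eventually_ge_atTop (1 + a⁻¹)]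
    with R hR hR1
  have h2 : 1 ≤ a * (R - 1) := by
    calc 1 = a * a⁻¹ := (mul_inv_cancel₀ ha.ne').symm
      _ ≤ a * (R - 1) := by gcongr; linarith
  have h3 : Real.exp (a * (R - 1)) / 2 ≤ Real.exp (a * (R - 1)) - 1 := by
    linarith [Real.add_one_le_exp (a * (R - 1))]
  refine lt_of_lt_of_le ?_ (pow_le_pow_left₀ (by positivity) h3 2)
  have h4 : (Real.exp (a * (R - 1)) / 2) ^ 2
      = Real.exp ((2 * a - t) * R) * (Real.exp (t * R) / (4 * Real.exp (2 * a))) := by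
    rw [div_pow, ← Real.exp_nat_mul, ← mul_div_assoc, ← Real.exp_add, div_eq_div_iff
      (by norm_num) (by positivity), mul_left_comm, ← Real.exp_add, mul_comm]
    push_cast
    ring_nf
  have h5 : K * Real.exp (t * R)
      = 4 * K * Real.exp (2 * a) * (Real.exp (t * R) / (4 * Real.exp (2 * a))) := by
    field_simp
  rw [h4, h5]
  exact mul_lt_mul_of_pos_right hR (by positivity)

/-- The trapezoidal upper bound for the integral of the convex function `exp`. -/
theorem Real.exp_sub_one_le_mul_exp_add_one {h : ℝ} (hh : 0 ≤ h) :
    Real.exp h - 1 ≤ h * (Real.exp h + 1) / 2 := by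
  have hder : ∀ x : ℝ, HasDerivAt (fun x : ℝ => x * (Real.exp x + 1) / 2 - Real.exp x)
      ((1 * (Real.exp x + 1) + x * Real.exp x) / 2 - Real.exp x) x := fun x =>
    (((hasDerivAt_id x).mul ((Real.hasDerivAt_exp x).add_const 1)).div_const 2).sub
      (Real.hasDerivAt_exp x)
  have hmono : Monotone fun x : ℝ => x * (Real.exp x + 1) / 2 - Real.exp x := by
    refine monotone_of_deriv_nonneg (fun x => (hder x).differentiableAt) fun x => ?_
    rw [(hder x).deriv]
    have h1 : (1 - x) * Real.exp x ≤ Real.exp (-x) * Real.exp x :=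
      mul_le_mul_of_nonneg_right (by linarith [Real.add_one_le_exp (-x)]) (Real.exp_pos x).le
    rw [← Real.exp_add, neg_add_cancel, Real.exp_zero] at h1
    nlinarith
  have := hmono hh
  simp at this
  linarith

theorem Real.sq_exp_sub_exp_le (s t : ℝ) :
    (Real.exp s - Real.exp t) ^ 2 ≤ (s - t) ^ 2 / 2 * (Real.exp s ^ 2 + Real.exp t ^ 2) := by
  wlog hst : t ≤ s generalizing s t
  · have := this t s (le_of_not_ge hst)
    linarith
  have h1 : Real.exp s - Real.exp t ≤ (s - t) * (Real.exp s + Real.exp t) / 2 := by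
    have h := mul_le_mul_of_nonneg_right (Real.exp_sub_one_le_mul_exp_add_one (sub_nonneg.2 hst))
      (Real.exp_pos t).le
    have e : Real.exp (s - t) * Real.exp t = Real.exp s := by rw [← Real.exp_add]; ring_nf
    rw [sub_mul, e] at h
    calc Real.exp s - Real.exp t = Real.exp s - 1 * Real.exp t := by ring
      _ ≤ _ := h
      _ = (s - t) * (Real.exp (s - t) * Real.exp t + Real.exp t) / 2 := by ring
      _ = _ := by rw [e]
  have h2 : 0 ≤ Real.exp s - Real.exp t := sub_nonneg.2 (Real.exp_le_exp.2 hst)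
  calc (Real.exp s - Real.exp t) ^ 2 ≤ ((s - t) * (Real.exp s + Real.exp t) / 2) ^ 2 :=
        pow_le_pow_left₀ h2 h1 2
    _ = (s - t) ^ 2 / 4 * (Real.exp s + Real.exp t) ^ 2 := by ring
    _ ≤ (s - t) ^ 2 / 4 * (2 * (Real.exp s ^ 2 + Real.exp t ^ 2)) := by
        gcongr; nlinarith [sq_nonneg (Real.exp s - Real.exp t)]
    _ = _ := by ring

namespace WGraph

variable {X : Type*}

theorem energy_sub_comm (G : WGraph X) (u v : X → ℝ) : G.energy (u - v) = G.energy (v - u) := by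
  unfold energy
  congr 1
  refine tsum_congr fun x => tsum_congr fun y => ?_
  simp only [Pi.sub_apply]; ring_nf

variable [PseudoMetricSpace X]

open Filter Topology in
/-- Cheeger's inequality extends from the finitely supported functions to the form domain. -/
theorem IsIntrinsic.cheeger_inequality [Countable X] {G : WGraph X} {m : X → ℝ}
    (hm : ∀ x, 0 < m x) (hd : G.IsIntrinsic m) {c : ℝ} (hc : 0 < c)
    (hcα : ENNReal.ofReal c ≤ G.cheegerConst m) {u : X → ℝ} (hu : u ∈ G.formDomain m) :
    ENNReal.ofReal (c ^ 2 / 2) * normSq m u ≤ G.energy u := by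
  set k : ℝ := c ^ 2 / 2
  obtain ⟨⟨hn, hq⟩, happ⟩ := hu
  obtain ⟨q, hq0, hqE⟩ : ∃ q : ℝ, 0 ≤ q ∧ G.energy u = ENNReal.ofReal q :=
    ⟨_, ENNReal.toReal_nonneg, (ENNReal.ofReal_toReal hq.ne).symm⟩
  have key : ∀ δ : ℝ, 0 < δ → ENNReal.ofReal k * normSq m u
      ≤ ENNReal.ofReal ((1 + δ) ^ 2 * q + (1 + δ) ^ 2 * δ + k * (δ * (1 + δ))) := by
    intro δ hδ
    obtain ⟨φ, hφ, hlt⟩ := happ (ENNReal.ofReal (δ ^ 2)) (ENNReal.ofReal_pos.2 (by positivity))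
    have hN : normSq m (u - φ) ≤ ENNReal.ofReal (δ ^ 2) := le_add_self.trans hlt.le
    have hE : G.energy (φ - u) ≤ ENNReal.ofReal (δ ^ 2) := by
      rw [G.energy_sub_comm]; exact le_self_add.trans hlt.le
    have h1 : normSq m u ≤ ENNReal.ofReal (1 + δ) * normSq m φ
        + ENNReal.ofReal (1 + δ⁻¹) * ENNReal.ofReal (δ ^ 2) := by
      have := normSq_add_le hm hδ φ (u - φ)
      rw [add_sub_cancel] at this
      exact this.trans (by gcongr)
    have h2 : G.energy φ ≤ ENNReal.ofReal (1 + δ) * ENNReal.ofReal q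
        + ENNReal.ofReal (1 + δ⁻¹) * ENNReal.ofReal (δ ^ 2) := by
      have := G.energy_add_le hδ u (φ - u)
      rw [add_sub_cancel, hqE] at this
      exact this.trans (by gcongr)
    calc ENNReal.ofReal k * normSq m u
        ≤ ENNReal.ofReal k * (ENNReal.ofReal (1 + δ) * normSq m φ
          + ENNReal.ofReal (1 + δ⁻¹) * ENNReal.ofReal (δ ^ 2)) := by gcongr
      _ = ENNReal.ofReal (1 + δ) * (ENNReal.ofReal k * normSq m φ)
          + ENNReal.ofReal k * (ENNReal.ofReal (1 + δ⁻¹) * ENNReal.ofReal (δ ^ 2)) := by ring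
      _ ≤ ENNReal.ofReal (1 + δ) * (ENNReal.ofReal (1 + δ) * ENNReal.ofReal q
          + ENNReal.ofReal (1 + δ⁻¹) * ENNReal.ofReal (δ ^ 2))
          + ENNReal.ofReal k * (ENNReal.ofReal (1 + δ⁻¹) * ENNReal.ofReal (δ ^ 2)) := by
          gcongr
          exact (hd.cheeger_inequality_of_finite hc hcα hφ).trans h2
      _ = _ := by
          rw [← ENNReal.ofReal_mul (by positivity), ← ENNReal.ofReal_mul (by positivity),
            ← ENNReal.ofReal_add (by positivity) (by positivity),
            ← ENNReal.ofReal_mul (by positivity), ← ENNReal.ofReal_mul (by positivity),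
            ← ENNReal.ofReal_add (by positivity) (by positivity)]
          congr 1
          field_simp
          ring
  have hlim : Tendsto (fun δ : ℝ =>
      ENNReal.ofReal ((1 + δ) ^ 2 * q + (1 + δ) ^ 2 * δ + k * (δ * (1 + δ)))) (𝓝[>] 0)
      (𝓝 (G.energy u)) := by
    have hcont : Continuous fun δ : ℝ =>
      ENNReal.ofReal ((1 + δ) ^ 2 * q + (1 + δ) ^ 2 * δ + k * (δ * (1 + δ))) :=
      ENNReal.continuous_ofReal.comp (by fun_prop)
    have := (hcont.tendsto 0).mono_left (nhdsWithin_le_nhds (s := Set.Ioi 0))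
    simpa [hqE] using this
  exact ge_of_tendsto hlim (eventually_nhdsWithin_of_forall key)

/-- The test function `(exp (a (R - d(o, ·))) - 1)₊`, supported in the ball of radius `R`
about `o`. -/
noncomputable def expCutoff (a R : ℝ) (o x : X) : ℝ :=
  Real.exp (max (a * (R - dist o x)) 0) - 1

/-- The density that dominates the energy of `expCutoff`. The summand `1` accounts for the edges
that leave the ball. -/
noncomputable def expDensity (a R : ℝ) (o : X) : X → ℝ :=
  (Metric.closedBall o R).indicator fun x => (expCutoff a R o x + 1) ^ 2 + 1

theorem expCutoff_nonneg (a R : ℝ) (o x : X) : 0 ≤ expCutoff a R o x := by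
  have : (1 : ℝ) ≤ Real.exp (max (a * (R - dist o x)) 0) := Real.one_le_exp (le_max_right _ _)
  simpa only [expCutoff, sub_nonneg] using this

theorem expCutoff_eq_zero {a R : ℝ} (ha : 0 < a) {o x : X} (hx : x ∉ Metric.closedBall o R) :
    expCutoff a R o x = 0 := by
  rw [Metric.mem_closedBall, dist_comm, not_le] at hx
  rw [expCutoff, max_eq_right (mul_nonpos_of_nonneg_of_nonpos ha.le (by linarith)), Real.exp_zero,
    sub_self]

theorem expDensity_nonneg (a R : ℝ) (o x : X) : 0 ≤ expDensity a R o x :=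
  Set.indicator_nonneg (fun _ _ => by positivity) x

/-- The pointwise energy estimate. Since `expCutoff` is `exp` of a truncated function minus one, an
edge that leaves the ball is treated as an edge to a point where the exponential equals `1`. -/
theorem sq_expCutoff_sub_le {a R : ℝ} (ha : 0 < a) (o x y : X) :
    (expCutoff a R o x - expCutoff a R o y) ^ 2
      ≤ a ^ 2 / 2 * (dist x y ^ 2 * (expDensity a R o x + expDensity a R o y)) := by
  by_cases hout : x ∉ Metric.closedBall o R ∧ y ∉ Metric.closedBall o R
  · rw [expCutoff_eq_zero ha hout.1, expCutoff_eq_zero ha hout.2]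
    have := expDensity_nonneg a R o x
    have := expDensity_nonneg a R o y
    simp only [sub_self, ne_eq, OfNat.ofNat_ne_zero, not_false_eq_true, zero_pow]
    positivity
  have hsum : (expCutoff a R o x + 1) ^ 2 + (expCutoff a R o y + 1) ^ 2
      ≤ expDensity a R o x + expDensity a R o y := by
    by_cases hx : x ∈ Metric.closedBall o R <;> by_cases hy : y ∈ Metric.closedBall o R
    · simp only [expDensity, Set.indicator_of_mem hx, Set.indicator_of_mem hy]; linarith
    · simp only [expDensity, Set.indicator_of_mem hx, Set.indicator_of_notMem hy,
        expCutoff_eq_zero ha hy]; linarith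
    · simp only [expDensity, Set.indicator_of_notMem hx, Set.indicator_of_mem hy,
        expCutoff_eq_zero ha hx]; linarith
    · exact absurd ⟨hx, hy⟩ hout
  set p := max (a * (R - dist o x)) 0 with hp
  set q := max (a * (R - dist o y)) 0 with hq
  have hpq : (p - q) ^ 2 ≤ a ^ 2 * dist x y ^ 2 := by
    rw [← mul_pow, ← sq_abs]
    refine pow_le_pow_left₀ (abs_nonneg _) ?_ 2
    refine (abs_max_sub_max_le_abs _ _ _).trans ?_
    rw [← mul_sub, abs_mul, abs_of_pos ha]
    gcongr
    rw [sub_sub_sub_cancel_left, dist_comm o y, dist_comm o x, dist_comm x y]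
    exact abs_dist_sub_le y x o
  have h := Real.sq_exp_sub_exp_le p q
  have ex : expCutoff a R o x + 1 = Real.exp p := by simp [expCutoff, hp]
  have ey : expCutoff a R o y + 1 = Real.exp q := by simp [expCutoff, hq]
  calc (expCutoff a R o x - expCutoff a R o y) ^ 2 = (Real.exp p - Real.exp q) ^ 2 := by
        rw [← ex, ← ey]; ring
    _ ≤ (p - q) ^ 2 / 2 * (Real.exp p ^ 2 + Real.exp q ^ 2) := h
    _ ≤ (a ^ 2 * dist x y ^ 2) / 2 * (expDensity a R o x + expDensity a R o y) := by
        rw [← ex, ← ey]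
        gcongr
    _ = _ := by ring

theorem IsIntrinsic.energy_expCutoff_le {G : WGraph X} {m : X → ℝ} (hd : G.IsIntrinsic m)
    {a R : ℝ} (ha : 0 < a) (o : X) :
    G.energy (expCutoff a R o)
      ≤ ENNReal.ofReal (a ^ 2 / 2) * ∑' x, ENNReal.ofReal (expDensity a R o x * m x) := by
  rw [← ENNReal.mul_le_mul_iff_right two_ne_zero ENNReal.ofNat_ne_top, two_mul_energy]
  calc ∑' x, ∑' y, ENNReal.ofReal (G.b x y * (expCutoff a R o x - expCutoff a R o y) ^ 2)
      ≤ ∑' x, ∑' y, ENNReal.ofReal (a ^ 2 / 2) * ENNReal.ofReal (G.b x y * dist x y ^ 2 *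
          (expDensity a R o x + expDensity a R o y)) := by
        refine ENNReal.tsum_le_tsum fun x => ENNReal.tsum_le_tsum fun y => ?_
        rw [← ENNReal.ofReal_mul (by positivity)]
        refine ENNReal.ofReal_le_ofReal ?_
        refine (mul_le_mul_of_nonneg_left (sq_expCutoff_sub_le ha o x y) (G.nonneg x y)).trans
          (le_of_eq (by ring))
    _ ≤ ENNReal.ofReal (a ^ 2 / 2) * (2 * ∑' x, ENNReal.ofReal (expDensity a R o x * m x)) := by
        simp_rw [ENNReal.tsum_mul_left]
        gcongr
        exact hd.tsum_mul_add_le (expDensity_nonneg a R o)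
    _ = _ := by ring

/-- Up to a multiple of the volume of the ball, the density is the square of the test function. -/
theorem tsum_expDensity_le {m : X → ℝ} (hm : ∀ x, 0 < m x) {a R ε : ℝ} (hε : 0 < ε) (o : X) :
    ∑' x, ENNReal.ofReal (expDensity a R o x * m x)
      ≤ ENNReal.ofReal (1 + ε) * normSq m (expCutoff a R o)
        + ENNReal.ofReal (2 + ε⁻¹) * vol m (Metric.closedBall o R) := by
  rw [vol_eq_tsum_indicator, normSq, ← ENNReal.tsum_mul_left, ← ENNReal.tsum_mul_left,
    ← ENNReal.tsum_add]
  refine ENNReal.tsum_le_tsum fun x => ?_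
  by_cases hx : x ∈ Metric.closedBall o R
  · have := (hm x).le
    rw [expDensity, Set.indicator_of_mem hx, Set.indicator_of_mem hx,
      ← ENNReal.ofReal_mul (by positivity), ← ENNReal.ofReal_mul (by positivity),
      ← ENNReal.ofReal_add (by positivity) (by positivity)]
    refine ENNReal.ofReal_le_ofReal ?_
    rw [← mul_assoc, ← add_mul]
    refine mul_le_mul_of_nonneg_right ?_ this
    generalize expCutoff a R o x = f
    have h1 : ε * f ^ 2 + ε⁻¹ - 2 * f = ε⁻¹ * (ε * f - 1) ^ 2 := by field_simp; ring
    have h2 : 0 ≤ ε⁻¹ * (ε * f - 1) ^ 2 := by positivity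
    linarith
  · simp [expDensity, Set.indicator_of_notMem hx]

theorem normSq_expCutoff_lt_top {m : X → ℝ} {a R : ℝ} (ha : 0 < a) {o : X}
    (hV : vol m (Metric.closedBall o R) ≠ ⊤) : normSq m (expCutoff a R o) < ⊤ := by
  have hle : normSq m (expCutoff a R o)
      ≤ ENNReal.ofReal (Real.exp (max (a * R) 0) ^ 2) * vol m (Metric.closedBall o R) := by
    rw [vol_eq_tsum_indicator, normSq, ← ENNReal.tsum_mul_left]
    refine ENNReal.tsum_le_tsum fun x => ?_
    by_cases hx : x ∈ Metric.closedBall o R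
    · rw [Set.indicator_of_mem hx, ENNReal.ofReal_mul (sq_nonneg _)]
      gcongr
      · exact expCutoff_nonneg a R o x
      · have h1 : max (a * (R - dist o x)) 0 ≤ max (a * R) 0 := by
          gcongr; linarith [dist_nonneg (x := o) (y := x)]
        rw [expCutoff]
        linarith [Real.exp_le_exp.2 h1]
    · simp [expCutoff_eq_zero ha hx]
  exact hle.trans_lt (ENNReal.mul_lt_top ENNReal.ofReal_lt_top hV.lt_top)

theorem le_normSq_expCutoff {m : X → ℝ} {a R : ℝ} (ha : 0 < a) (hR : 1 ≤ R) (o : X) :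
    ENNReal.ofReal ((Real.exp (a * (R - 1)) - 1) ^ 2) * vol m (Metric.closedBall o 1)
      ≤ normSq m (expCutoff a R o) := by
  rw [vol_eq_tsum_indicator, normSq, ← ENNReal.tsum_mul_left]
  refine ENNReal.tsum_le_tsum fun x => ?_
  by_cases hx : x ∈ Metric.closedBall o 1
  · rw [Set.indicator_of_mem hx, ENNReal.ofReal_mul (sq_nonneg _)]
    rw [Metric.mem_closedBall, dist_comm] at hx
    have h0 : 0 ≤ a * (R - 1) := mul_nonneg ha.le (by linarith)
    have h1 : a * (R - 1) ≤ max (a * (R - dist o x)) 0 := le_max_of_le_left (by gcongr)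
    have h2 : 0 ≤ Real.exp (a * (R - 1)) - 1 := sub_nonneg.2 (Real.one_le_exp h0)
    have h3 : Real.exp (a * (R - 1)) - 1 ≤ expCutoff a R o x :=
      sub_le_sub_right (Real.exp_le_exp.2 h1) 1
    gcongr
  · simp [Set.indicator_of_notMem hx]

/-- If `a < c ≤ α`, Cheeger's inequality for `expCutoff a R o` forces exponential growth with
rate `2 a` of the balls about `o`, uniformly in `o`. -/
theorem IsIntrinsic.exists_le_mul_vol_closedBall [Countable X] {G : WGraph X} {m : X → ℝ}
    (hm : ∀ x, 0 < m x) (hd : G.IsIntrinsic m) (hD : G.formDomain m = G.maxFormDomain m)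
    {a c : ℝ} (ha : 0 < a) (hac : a < c) (hcα : ENNReal.ofReal c ≤ G.cheegerConst m) :
    ∃ K : ℝ, 0 ≤ K ∧ ∀ (R : ℝ) (o : X), 1 ≤ R → vol m (Metric.closedBall o R) ≠ ⊤ →
      ENNReal.ofReal ((Real.exp (a * (R - 1)) - 1) ^ 2) * vol m (Metric.closedBall o 1)
        ≤ ENNReal.ofReal K * vol m (Metric.closedBall o R) := by
  have hc := ha.trans hac
  -- With this choice `c² = (1 + 2 ε) a²`.
  obtain ⟨ε, hε, hcε⟩ : ∃ ε : ℝ, 0 < ε ∧ c ^ 2 = (1 + 2 * ε) * a ^ 2 := by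
    refine ⟨(c ^ 2 - a ^ 2) / (2 * a ^ 2), div_pos (by nlinarith) (by positivity), ?_⟩
    field_simp; ring
  refine ⟨(2 + ε⁻¹) / ε, by positivity, fun R o hR hV => ?_⟩
  refine (le_normSq_expCutoff ha hR o).trans ?_
  have hN := normSq_expCutoff_lt_top ha hV
  have hH := tsum_expDensity_le hm hε o (a := a) (R := R)
  have hE := hd.energy_expCutoff_le ha o (R := R)
  have hE' := hE.trans (mul_le_mul_right hH _)
  have hmem : expCutoff a R o ∈ G.formDomain m := by
    rw [hD]
    refine ⟨hN, hE'.trans_lt (ENNReal.mul_lt_top ENNReal.ofReal_lt_top (ENNReal.add_lt_top.2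
      ⟨ENNReal.mul_lt_top ENNReal.ofReal_lt_top hN,
        ENNReal.mul_lt_top ENNReal.ofReal_lt_top hV.lt_top⟩))⟩
  have hfinal := (hd.cheeger_inequality hm hc hcα hmem).trans hE'
  rw [← ENNReal.ofReal_toReal hN.ne, ← ENNReal.ofReal_toReal hV] at hfinal ⊢
  have hn := ENNReal.toReal_nonneg (a := normSq m (expCutoff a R o))
  have hv := ENNReal.toReal_nonneg (a := vol m (Metric.closedBall o R))
  generalize (normSq m (expCutoff a R o)).toReal = n at *
  generalize (vol m (Metric.closedBall o R)).toReal = V at *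
  rw [← ENNReal.ofReal_mul (by positivity), ← ENNReal.ofReal_mul (by positivity),
    ← ENNReal.ofReal_mul (by positivity), ← ENNReal.ofReal_add (by positivity) (by positivity),
    ← ENNReal.ofReal_mul (by positivity), ENNReal.ofReal_le_ofReal_iff (by positivity), hcε]
    at hfinal
  rw [← ENNReal.ofReal_mul (by positivity)]
  refine ENNReal.ofReal_le_ofReal ?_
  have h1 : a ^ 2 / 2 * ((1 + 2 * ε) * n) ≤ a ^ 2 / 2 * ((1 + ε) * n + (2 + ε⁻¹) * V) := by
    linarith
  have h2 := le_of_mul_le_mul_left h1 (by positivity)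
  rw [div_mul_eq_mul_div, le_div_iff₀ hε]
  linarith

theorem vol_closedBall_one_ne_zero {m : X → ℝ} (hm : ∀ x, 0 < m x) (x : X) :
    vol m (Metric.closedBall x 1) ≠ 0 := by
  intro h0
  rw [vol, ENNReal.tsum_eq_zero] at h0
  have := h0 ⟨x, Metric.mem_closedBall_self zero_le_one⟩
  rw [ENNReal.ofReal_eq_zero] at this
  exact absurd (hm x) (not_lt.2 this)

theorem volumeGrowth_nonneg {m : X → ℝ} (hm : ∀ x, 0 < m x) : 0 ≤ volumeGrowth m := by
  refine Filter.le_liminf_of_le (by isBoundedDefault) ?_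
  filter_upwards [Filter.eventually_ge_atTop 1] with r hr
  refine le_iInf₂ fun x hx => EReal.div_nonneg ?_ (by exact_mod_cast zero_le_one.trans hr)
  rw [ENNReal.zero_le_log_iff, ENNReal.le_div_iff_mul_le (.inl ?_) (.inl hx), one_mul]
  · exact ENNReal.tsum_mono_subtype (fun x => ENNReal.ofReal (m x))
      (Metric.closedBall_subset_closedBall hr)
  · exact vol_closedBall_one_ne_zero hm x

theorem IsIntrinsic.two_mul_cheegerConst_le_volumeGrowth [Countable X] {G : WGraph X} {m : X → ℝ}
    (hm : ∀ x, 0 < m x) (hd : G.IsIntrinsic m) (hD : G.formDomain m = G.maxFormDomain m) :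
    2 * (G.cheegerConst m : EReal) ≤ volumeGrowth m := by
  by_contra! hlt
  obtain ⟨t, hμt, htα⟩ := EReal.lt_iff_exists_real_btwn.1 hlt
  obtain ⟨s, hts, hsα⟩ := EReal.lt_iff_exists_real_btwn.1 htα
  obtain ⟨s', hss', hsα'⟩ := EReal.lt_iff_exists_real_btwn.1 hsα
  rw [EReal.coe_lt_coe_iff] at hts hss'
  have ht0 : 0 < t := by exact_mod_cast (volumeGrowth_nonneg hm).trans_lt hμt
  have hcα : ENNReal.ofReal (s' / 2) ≤ G.cheegerConst m := by
    rcases eq_or_ne (G.cheegerConst m) ⊤ with h | h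
    · simp [h]
    · rw [← ENNReal.ofReal_toReal h] at hsα' ⊢
      refine ENNReal.ofReal_le_ofReal ?_
      rw [EReal.coe_ennreal_ofReal, max_eq_left ENNReal.toReal_nonneg] at hsα'
      have : s' < 2 * (G.cheegerConst m).toReal := by
        rwa [← EReal.coe_lt_coe_iff, EReal.coe_mul]
      linarith
  obtain ⟨K, hK0, hK⟩ := hd.exists_le_mul_vol_closedBall hm hD (a := s / 2) (c := s' / 2)
    (by linarith) (by linarith) hcα
  have hfreq := Filter.frequently_lt_of_liminf_lt (by isBoundedDefault) hμt
  obtain ⟨R, hRlt, hR1, hRexp⟩ := (hfreq.and_eventually ((Filter.eventually_ge_atTop 1).and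
    (Real.eventually_mul_exp_lt_sq_exp_sub_one (a := s / 2) (t := t) (K := K)
      (by linarith) (by linarith)))).exists
  have hR0 : (0 : ℝ) < R := by linarith
  obtain ⟨o, ho⟩ := iInf_lt_iff.1 hRlt
  obtain ⟨hfin, ho⟩ := iInf_lt_iff.1 ho
  rw [EReal.div_lt_iff (by exact_mod_cast hR0) (EReal.coe_ne_top _), ← EReal.coe_mul,
    ← Real.log_exp (t * R), ← ENNReal.log_ofReal_of_pos (Real.exp_pos _),
    ENNReal.log_lt_log_iff, ENNReal.div_lt_iff (.inl (vol_closedBall_one_ne_zero hm o))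
    (.inl hfin)] at ho
  have h1 := (hK R o hR1 ho.ne_top).trans (mul_le_mul_right ho.le _)
  rw [← mul_assoc, ENNReal.mul_le_mul_iff_left (vol_closedBall_one_ne_zero hm o) hfin,
    ← ENNReal.ofReal_mul hK0, ENNReal.ofReal_le_ofReal_iff (by positivity)] at h1
  exact absurd hRexp (not_lt.2 h1)

end WGraph

/-! ### Finite balls and the density of the finitely supported functions -/

namespace WGraph

variable {X : Type*} [PseudoMetricSpace X]

/-- Every point `z ≠ x` of the open ball of radius `r` is the end of a walk of length less than
`r`, which leaves `x` along an edge; the rest of the walk is shorter than `r - w x y`. -/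
theorem ball_subset_iUnion_ball {G : WGraph X} {w : X → X → ℝ}
    (hd : ∀ x y, IsGLB (Set.range fun p : G.graph.Walk x y => G.walkLength w p) (dist x y))
    (x : X) (r : ℝ) :
    Metric.ball x r ⊆ {x} ∪ ⋃ y ∈ {y | G.graph.Adj x y}, Metric.ball y (r - w x y) := by
  intro z hz
  rw [Metric.mem_ball, dist_comm] at hz
  obtain ⟨_, ⟨p, rfl⟩, -, hp⟩ := (hd x z).exists_between hz
  cases p with
  | nil => exact .inl rfl
  | @cons _ y _ hxy p =>
    refine .inr (Set.mem_biUnion hxy ?_)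
    have h1 : dist y z ≤ G.walkLength w p := (hd y z).1 ⟨p, rfl⟩
    have h2 : w x y + G.walkLength w p < r := by simpa [walkLength] using hp
    rw [Metric.mem_ball, dist_comm]
    linarith

theorem dist_le_weight {G : WGraph X} {w : X → X → ℝ}
    (hd : ∀ x y, IsGLB (Set.range fun p : G.graph.Walk x y => G.walkLength w p) (dist x y))
    {x y : X} (hxy : G.graph.Adj x y) : dist x y ≤ w x y :=
  (hd x y).1 ⟨.cons hxy .nil, by simp [walkLength]⟩

/-- In a locally finite graph a path metric is discrete, since a walk that leaves `x` is at least
as long as the shortest edge at `x`. -/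
theorem exists_ball_subset_singleton {G : WGraph X} (hG : G.IsLocallyFinite) {w : X → X → ℝ}
    (hw : ∀ x y, G.graph.Adj x y → 0 < w x y)
    (hd : ∀ x y, IsGLB (Set.range fun p : G.graph.Walk x y => G.walkLength w p) (dist x y))
    (x : X) : ∃ δ > 0, Metric.ball x δ ⊆ {x} := by
  obtain ⟨y₀, hy₀⟩ := G.exists_neighbor x
  obtain ⟨y, hy, hmin⟩ := Set.exists_min_image _ (w x) (hG x) ⟨y₀, hy₀⟩
  refine ⟨w x y, hw x y hy, fun z hz => ?_⟩
  rcases ball_subset_iUnion_ball hd x _ hz with h | h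
  · exact h
  · obtain ⟨y', hy', hz'⟩ := Set.mem_iUnion₂.1 h
    have := Metric.pos_of_mem_ball hz'
    have := hmin y' hy'
    linarith

open Filter Topology in
/-- A discrete Hopf–Rinow theorem. An infinite ball of radius `r` about `x` contains an infinite
ball of radius `r - w x y` about some neighbor `y`. Iterating this gives a path of finite length,
whose limit cannot exist since points are isolated. -/
theorem finite_ball_of_isPathMetric [CompleteSpace X] {G : WGraph X} (hG : G.IsLocallyFinite)
    (hd : G.IsPathMetric) (x : X) (r : ℝ) : (Metric.ball x r).Finite := by
  obtain ⟨w, -, hw, hd⟩ := hd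
  by_contra hinf
  let S := {p : X × ℝ // (Metric.ball p.1 p.2).Infinite}
  have step : ∀ p : S, ∃ q : S, G.graph.Adj p.1.1 q.1.1 ∧ q.1.2 = p.1.2 - w p.1.1 q.1.1 := by
    rintro ⟨⟨x, r⟩, hinf⟩
    have : ∃ y ∈ {y | G.graph.Adj x y}, (Metric.ball y (r - w x y)).Infinite := by
      by_contra! h
      refine hinf (((Set.finite_singleton x).union ((hG x).biUnion fun y hy => ?_)).subset
        (ball_subset_iUnion_ball hd x r))
      exact h y hy
    obtain ⟨y, hy, hy'⟩ := this
    exact ⟨⟨(y, r - w x y), hy'⟩, hy, rfl⟩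
  choose f hf hfr using step
  let s : ℕ → S := fun n => f^[n] ⟨(x, r), hinf⟩
  have hs : ∀ n, s (n + 1) = f (s n) := fun n => Function.iterate_succ_apply' f n _
  have hadj : ∀ n, G.graph.Adj (s n).1.1 (s (n + 1)).1.1 := fun n => by rw [hs]; exact hf _
  have hrad : ∀ n, (s (n + 1)).1.2 = (s n).1.2 - w (s n).1.1 (s (n + 1)).1.1 :=
    fun n => by rw [hs]; exact hfr _
  have hpos : ∀ n, 0 < (s n).1.2 := fun n => by
    obtain ⟨z, hz⟩ := (s n).2.nonempty
    exact Metric.pos_of_mem_ball hz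
  have hsum : ∀ n, ∑ i ∈ Finset.range n, w (s i).1.1 (s (i + 1)).1.1 = r - (s n).1.2 := by
    intro n
    induction n with
    | zero => simp [s]
    | succ n ih => rw [Finset.sum_range_succ, ih, hrad n]; ring
  have hsummable : Summable fun n => w (s n).1.1 (s (n + 1)).1.1 :=
    summable_of_sum_range_le (c := r) (fun n => (hw _ _ (hadj n)).le)
      fun n => by rw [hsum]; linarith [hpos n]
  obtain ⟨z, hz⟩ := cauchySeq_tendsto_of_complete
    (cauchySeq_of_dist_le_of_summable _ (fun n => dist_le_weight hd (hadj n)) hsummable)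
  obtain ⟨δ, hδ, hball⟩ := exists_ball_subset_singleton hG hw hd z
  obtain ⟨N, hN⟩ := eventually_atTop.1 (hz.eventually (Metric.ball_mem_nhds z hδ))
  have h1 : (s N).1.1 = z := hball (hN N le_rfl)
  have h2 : (s (N + 1)).1.1 = z := hball (hN (N + 1) (Nat.le_succ N))
  have h3 := hadj N
  rw [h1, h2] at h3
  exact G.graph.loopless.irrefl z h3

open Filter Topology in
/-- If all balls are finite, multiplication with the cutoff functions `(2 - d(o, ·) / R)₊ ∧ 1`
approximates every function of the maximal form domain. -/
theorem IsIntrinsic.formDomain_eq_of_finite_ball {G : WGraph X} {m : X → ℝ} (hm : ∀ x, 0 < m x)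
    (hd : G.IsIntrinsic m) (o : X) (hfin : ∀ r, (Metric.ball o r).Finite) :
    G.formDomain m = G.maxFormDomain m := by
  refine Set.Subset.antisymm (fun u hu => hu.1) fun u hu => ⟨hu, fun ε hε => ?_⟩
  obtain ⟨hn, hq⟩ := hu
  -- `χ R` is the complementary cutoff: it vanishes near `o` and is `1` far away.
  let χ : ℝ → X → ℝ := fun R x => max 0 (min 1 (dist o x / R - 1))
  have hχ0 : ∀ R x, 0 ≤ χ R x := fun R x => le_max_left _ _
  have hχ1 : ∀ R x, χ R x ≤ 1 := fun R x => max_le zero_le_one (min_le_left _ _)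
  have hχin : ∀ R x, 0 < R → dist o x ≤ R → χ R x = 0 := fun R x hR hx =>
    max_eq_left ((min_le_right _ _).trans (by rw [sub_nonpos, div_le_one hR]; exact hx))
  have hχout : ∀ R x, 0 < R → 2 * R ≤ dist o x → χ R x = 1 := fun R x hR hx => by
    have : 1 ≤ dist o x / R - 1 := by rw [le_sub_iff_add_le, le_div_iff₀ hR]; linarith
    simp only [χ]
    rw [min_eq_left this, max_eq_right zero_le_one]
  have hχlip : ∀ R x y, 0 < R → (χ R x - χ R y) ^ 2 ≤ (R ^ 2)⁻¹ * dist x y ^ 2 := by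
    intro R x y hR
    rw [← inv_pow, ← mul_pow, ← sq_abs]
    refine pow_le_pow_left₀ (abs_nonneg _) ?_ 2
    have h1 : |χ R x - χ R y| ≤ |(dist o x / R - 1) - (dist o y / R - 1)| := by
      simp only [χ, max_comm (0 : ℝ), min_comm (1 : ℝ)]
      exact (abs_max_sub_max_le_abs _ _ _).trans (abs_inf_sub_inf_le_abs _ _ _)
    refine h1.trans ?_
    rw [sub_sub_sub_cancel_right, ← sub_div, abs_div, abs_of_pos hR, div_eq_inv_mul]
    gcongr
    rw [dist_comm o x, dist_comm o y]
    exact abs_dist_sub_le x y o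
  -- The density of `‖u‖² + 2 Q(u)`; its tails control the energy and the norm of `u * χ R`.
  let e : X → ℝ≥0∞ := fun x => ENNReal.ofReal (u x ^ 2 * m x)
    + ∑' y, ENNReal.ofReal (G.b x y * (u x - u y) ^ 2)
  have hetop : ∑' x, e x ≠ ⊤ := by
    rw [ENNReal.tsum_add, ← two_mul_energy]
    exact ENNReal.add_ne_top.2 ⟨hn.ne, ENNReal.mul_ne_top (by simp) hq.ne⟩
  have hbound : ∀ R, 0 < R → G.energy (u * χ R) + normSq m (u * χ R)
      ≤ ∑' x, {x | R < dist o x}.indicator e x + ENNReal.ofReal (R ^ 2)⁻¹ * normSq m u := by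
    intro R hR
    have hE : G.energy (u * χ R) ≤ ∑' x, {x | R < dist o x}.indicator
        (fun x => ∑' y, ENNReal.ofReal (G.b x y * (u x - u y) ^ 2)) x
        + ENNReal.ofReal (R ^ 2)⁻¹ * normSq m u := by
      rw [← ENNReal.mul_le_mul_iff_right two_ne_zero ENNReal.ofNat_ne_top, two_mul_energy]
      calc ∑' x, ∑' y, ENNReal.ofReal (G.b x y * ((u * χ R) x - (u * χ R) y) ^ 2)
          ≤ ∑' x, ∑' y, (2 * ENNReal.ofReal (χ R x ^ 2 * (G.b x y * (u x - u y) ^ 2))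
            + 2 * (ENNReal.ofReal (R ^ 2)⁻¹ *
              ENNReal.ofReal (G.b x y * dist x y ^ 2 * u y ^ 2))) := by
            refine ENNReal.tsum_le_tsum fun x => ENNReal.tsum_le_tsum fun y => ?_
            have hb := G.nonneg x y
            rw [show (2 : ℝ≥0∞) = ENNReal.ofReal 2 by simp, ← ENNReal.ofReal_mul (by positivity),
              ← ENNReal.ofReal_mul (by positivity), ← ENNReal.ofReal_mul (by positivity),
              ← ENNReal.ofReal_add (by positivity) (by positivity)]
            refine ENNReal.ofReal_le_ofReal ?_
            have h1 : ((u * χ R) x - (u * χ R) y) ^ 2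
                ≤ 2 * (χ R x ^ 2 * (u x - u y) ^ 2)
                  + 2 * (u y ^ 2 * (χ R x - χ R y) ^ 2) := by
              simp only [Pi.mul_apply]
              nlinarith [sq_nonneg (χ R x * (u x - u y) - u y * (χ R x - χ R y))]
            have h2 : u y ^ 2 * (χ R x - χ R y) ^ 2 ≤ u y ^ 2 * ((R ^ 2)⁻¹ * dist x y ^ 2) := by
              gcongr; exact hχlip R x y hR
            refine (mul_le_mul_of_nonneg_left (h1.trans (add_le_add_right
              (mul_le_mul_of_nonneg_left h2 zero_le_two) _)) hb).trans (le_of_eq ?_)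
            ring
        _ ≤ 2 * (∑' x, {x | R < dist o x}.indicator
              (fun x => ∑' y, ENNReal.ofReal (G.b x y * (u x - u y) ^ 2)) x
            + ENNReal.ofReal (R ^ 2)⁻¹ * normSq m u) := by
            simp_rw [ENNReal.tsum_add, ENNReal.tsum_mul_left]
            rw [mul_add]
            gcongr with x
            · by_cases hx : R < dist o x
              · rw [Set.indicator_of_mem (by exact hx)]
                refine ENNReal.tsum_le_tsum fun y => ENNReal.ofReal_le_ofReal ?_
                exact mul_le_of_le_one_left (mul_nonneg (G.nonneg x y) (sq_nonneg _))
                  (pow_le_one₀ (hχ0 R x) (hχ1 R x))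
              · simp [hχin R x hR (not_lt.1 hx)]
            · exact hd.tsum_mul_right_le (v := fun x => u x ^ 2) fun x => sq_nonneg _
    have hN : normSq m (u * χ R) ≤ ∑' x, {x | R < dist o x}.indicator
        (fun x => ENNReal.ofReal (u x ^ 2 * m x)) x := by
      refine ENNReal.tsum_le_tsum fun x => ?_
      by_cases hx : R < dist o x
      · rw [Set.indicator_of_mem (by exact hx)]
        refine ENNReal.ofReal_le_ofReal (mul_le_mul_of_nonneg_right ?_ (hm x).le)
        rw [Pi.mul_apply, mul_pow]
        exact mul_le_of_le_one_right (sq_nonneg _) (pow_le_one₀ (hχ0 R x) (hχ1 R x))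
      · simp [hχin R x hR (not_lt.1 hx)]
    refine (add_le_add hE hN).trans (le_of_eq ?_)
    simp only [e, Set.indicator_add, ENNReal.tsum_add]
    ring
  have hlim1 : ∃ R₀ : ℝ, ∀ R ≥ R₀, ∑' x, {x | R < dist o x}.indicator e x < ε / 2 := by
    have h1 := ENNReal.tendsto_tsum_compl_atTop_zero hetop
    obtain ⟨s, hs⟩ := (h1.eventually (gt_mem_nhds (ENNReal.half_pos hε.ne'))).exists
    obtain ⟨R₀, hR₀⟩ := (s.image (dist o)).exists_le
    refine ⟨R₀, fun R hR => lt_of_le_of_lt ?_ hs⟩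
    rw [← tsum_subtype]
    refine ENNReal.tsum_mono_subtype e fun x hx hxs => ?_
    have := hR₀ _ (Finset.mem_image_of_mem (dist o) hxs)
    exact absurd (Set.mem_ofPred.1 hx) (not_lt.2 (this.trans hR))
  obtain ⟨R₀, hR₀⟩ := hlim1
  have hlim2 : Tendsto (fun R : ℝ => ENNReal.ofReal (R ^ 2)⁻¹ * normSq m u) atTop (𝓝 0) := by
    have h1 : Tendsto (fun R : ℝ => (R ^ 2)⁻¹) atTop (𝓝 0) :=
      (tendsto_pow_atTop two_ne_zero).inv_tendsto_atTop
    have h2 := ENNReal.Tendsto.mul_const (ENNReal.tendsto_ofReal h1) (.inr hn.ne)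
    simpa using h2
  obtain ⟨R, hR1, hRpos, hR2⟩ := ((eventually_ge_atTop R₀).and ((eventually_gt_atTop 0).and
    (hlim2.eventually (gt_mem_nhds (ENNReal.half_pos hε.ne'))))).exists
  refine ⟨u * (1 - χ R), (hfin (2 * R)).subset fun x hx => ?_, ?_⟩
  · by_contra h
    rw [Metric.mem_ball, dist_comm, not_lt] at h
    exact hx (by simp [hχout R x hRpos h])
  · rw [show u - u * (1 - χ R) = u * χ R by ring]
    calc _ ≤ _ := hbound R hRpos
      _ < ε / 2 + ε / 2 := ENNReal.add_lt_add (hR₀ R hR1) hR2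
      _ = ε := ENNReal.add_halves ε

end WGraph

/-! ### Infinite paths of infinite measure -/

namespace WGraph

variable {X : Type*}

/-- The coordinates of `u` in `ℓ²(X ⊕ X × X)`, for which the sum of the squares is
`Q(u) + ‖u‖²`. -/
noncomputable def formCoord (G : WGraph X) (m : X → ℝ) (u : X → ℝ) : X ⊕ X × X → ℝ :=
  Sum.elim (fun x => √(m x) * u x) fun e => √(G.b e.1 e.2 / 2) * (u e.1 - u e.2)

theorem tsum_sq_formCoord (G : WGraph X) {m : X → ℝ} (hm : ∀ x, 0 < m x) (u : X → ℝ) :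
    ∑' i, ENNReal.ofReal (G.formCoord m u i ^ 2) = G.energy u + normSq m u := by
  rw [Summable.tsum_sum ENNReal.summable ENNReal.summable, add_comm, ENNReal.tsum_prod']
  congr 1
  · rw [energy, ENNReal.div_eq_inv_mul, ← ENNReal.tsum_mul_left]
    refine tsum_congr fun x => ?_
    rw [← ENNReal.tsum_mul_left]
    refine tsum_congr fun y => ?_
    have h2 : (2 : ℝ≥0∞)⁻¹ = ENNReal.ofReal 2⁻¹ := by
      rw [ENNReal.ofReal_inv_of_pos zero_lt_two]; simp
    rw [h2, ← ENNReal.ofReal_mul (by positivity)]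
    simp only [formCoord, Sum.elim_inr]
    rw [mul_pow, Real.sq_sqrt (div_nonneg (G.nonneg x y) zero_le_two)]
    ring_nf
  · refine tsum_congr fun x => ?_
    simp only [formCoord, Sum.elim_inl]
    rw [mul_pow, Real.sq_sqrt (hm x).le, mul_comm]

theorem formCoord_sub (G : WGraph X) (m : X → ℝ) (u v : X → ℝ) :
    G.formCoord m (u - v) = G.formCoord m u - G.formCoord m v := by
  ext (x | e) <;> simp only [formCoord, Sum.elim_inl, Sum.elim_inr, Pi.sub_apply] <;> ring

theorem formCoord_add (G : WGraph X) (m : X → ℝ) (u v : X → ℝ) :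
    G.formCoord m (u + v) = G.formCoord m u + G.formCoord m v := by
  ext (x | e) <;> simp only [formCoord, Sum.elim_inl, Sum.elim_inr, Pi.add_apply] <;> ring

theorem formCoord_smul (G : WGraph X) (m : X → ℝ) (c : ℝ) (u : X → ℝ) :
    G.formCoord m (c • u) = c • G.formCoord m u := by
  ext (x | e) <;>
    simp only [formCoord, Sum.elim_inl, Sum.elim_inr, Pi.smul_apply, smul_eq_mul] <;> ring

theorem memℓp_formCoord (G : WGraph X) {m : X → ℝ} (hm : ∀ x, 0 < m x) {u : X → ℝ}
    (hu : u ∈ G.maxFormDomain m) : Memℓp (G.formCoord m u) 2 := by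
  have h : ∑' i, ENNReal.ofReal (G.formCoord m u i ^ 2) ≠ ⊤ := by
    rw [G.tsum_sq_formCoord hm]; exact ENNReal.add_ne_top.2 ⟨hu.2.ne, hu.1.ne⟩
  rw [memℓp_gen_iff (by simp)]
  refine (ENNReal.summable_toReal h).congr fun i => ?_
  rw [ENNReal.toReal_ofReal (sq_nonneg _)]
  simp

theorem energy_add_normSq_eq_norm_sq (G : WGraph X) {m : X → ℝ} (hm : ∀ x, 0 < m x) {u : X → ℝ}
    {v : lp (fun _ : X ⊕ X × X => ℝ) 2} (hv : (v : X ⊕ X × X → ℝ) = G.formCoord m u) :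
    G.energy u + normSq m u = ENNReal.ofReal (‖v‖ ^ 2) := by
  rw [← G.tsum_sq_formCoord hm, ← hv, ← real_inner_self_eq_norm_sq, lp.inner_eq_tsum,
    ENNReal.ofReal_tsum_of_nonneg (fun i => real_inner_self_nonneg) (lp.summable_inner v v)]
  refine tsum_congr fun i => ?_
  rw [real_inner_self_eq_norm_sq, Real.norm_eq_abs, sq_abs]

theorem normSq_lt_top_of_eq_formCoord (G : WGraph X) {m : X → ℝ} (hm : ∀ x, 0 < m x) {u : X → ℝ}
    {v : lp (fun _ : X ⊕ X × X => ℝ) 2} (hv : (v : X ⊕ X × X → ℝ) = G.formCoord m u) :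
    normSq m u < ⊤ :=
  lt_of_le_of_lt le_add_self
    ((G.energy_add_normSq_eq_norm_sq hm hv).trans_lt ENNReal.ofReal_lt_top)

/-- The coordinate vectors of the finitely supported functions. -/
noncomputable def finiteSupportSubmodule (G : WGraph X) (m : X → ℝ) :
    Submodule ℝ (lp (fun _ : X ⊕ X × X => ℝ) 2) where
  carrier := {v | ∃ φ : X → ℝ, (Function.support φ).Finite ∧
    (v : X ⊕ X × X → ℝ) = G.formCoord m φ}
  zero_mem' := ⟨0, by simp, by ext (x | e) <;> simp [formCoord]⟩
  add_mem' := by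
    rintro v w ⟨φ, hφ, hv⟩ ⟨ψ, hψ, hw⟩
    exact ⟨φ + ψ, (hφ.union hψ).subset (Function.support_add φ ψ),
      by rw [lp.coeFn_add, hv, hw, formCoord_add]⟩
  smul_mem' := by
    rintro c v ⟨φ, hφ, hv⟩
    exact ⟨c • φ, hφ.subset (Function.support_const_smul_subset c φ),
      by rw [lp.coeFn_smul, hv, formCoord_smul]⟩

theorem continuous_lp_apply {ι : Type*} (i : ι) :
    Continuous fun v : lp (fun _ : ι => ℝ) 2 => v i :=
  (LipschitzWith.of_dist_le_mul (K := 1) fun v w => by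
    rw [dist_eq_norm, dist_eq_norm, NNReal.coe_one, one_mul, ← Pi.sub_apply, ← lp.coeFn_sub]
    exact lp.norm_apply_le_norm two_ne_zero (v - w) i).continuous

/-- Limits of coordinate vectors are coordinate vectors, because these are cut out by linear
relations between finitely many coordinates. This replaces the completeness of the maximal form
domain. -/
theorem exists_eq_formCoord_of_mem_closure (G : WGraph X) {m : X → ℝ} (hm : ∀ x, 0 < m x)
    {v : lp (fun _ : X ⊕ X × X => ℝ) 2} (hv : v ∈ (G.finiteSupportSubmodule m).topologicalClosure) :
    ∃ u : X → ℝ, (v : X ⊕ X × X → ℝ) = G.formCoord m u := by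
  have hsub : ((G.finiteSupportSubmodule m).topologicalClosure : Set _)
      ⊆ {v : lp (fun _ : X ⊕ X × X => ℝ) 2 | ∀ e : X × X, v (.inr e)
        = √(G.b e.1 e.2 / 2) * (v (.inl e.1) / √(m e.1) - v (.inl e.2) / √(m e.2))} := by
    refine closure_minimal ?_ ?_
    · rintro v ⟨φ, -, hv⟩ e
      have h1 := (Real.sqrt_pos.2 (hm e.1)).ne'
      have h2 := (Real.sqrt_pos.2 (hm e.2)).ne'
      rw [hv]
      simp only [formCoord, Sum.elim_inl, Sum.elim_inr]
      rw [mul_div_cancel_left₀ _ h1, mul_div_cancel_left₀ _ h2]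
    · simp only [Set.ofPred_forall]
      refine isClosed_iInter fun e => isClosed_eq (continuous_lp_apply _) ?_
      exact continuous_const.mul (((continuous_lp_apply _).div_const _).sub
        ((continuous_lp_apply _).div_const _))
  refine ⟨fun x => v (.inl x) / √(m x), ?_⟩
  ext (x | e)
  · simp only [formCoord, Sum.elim_inl]
    rw [mul_div_cancel₀ _ (Real.sqrt_pos.2 (hm x)).ne']
  · exact hsub hv e

theorem single_mem_maxFormDomain [DecidableEq X] (G : WGraph X) (m : X → ℝ) (z : X) :
    (Pi.single z 1 : X → ℝ) ∈ G.maxFormDomain m := by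
  set φ : X → ℝ := Pi.single z 1
  have hφ : ∀ x, 0 ≤ φ x ∧ φ x ≤ 1 := fun x => by
    by_cases h : x = z
    · subst h; simp [φ]
    · simp [φ, h]
  have hfin : (Function.support φ).Finite :=
    (Set.finite_singleton z).subset Pi.support_single_subset
  refine ⟨(normSq_ne_top_of_finite m hfin).lt_top, ?_⟩
  have h1 : ∑' x, ∑' y, ENNReal.ofReal (G.b x y * φ x) ≠ ⊤ := by
    rw [tsum_eq_single z fun x hx => by simp [φ, hx]]
    simpa [φ] using (G.summable z).tsum_ofReal_ne_top
  have h2 : ∑' x, ∑' y, ENNReal.ofReal (G.b x y * φ y)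
      = ∑' x, ∑' y, ENNReal.ofReal (G.b x y * φ x) := by
    rw [ENNReal.tsum_comm]
    exact tsum_congr fun x => tsum_congr fun y => by rw [G.symm]
  have h3 : 2 * G.energy φ ≤ ∑' x, ∑' y, ENNReal.ofReal (G.b x y * φ x)
      + ∑' x, ∑' y, ENNReal.ofReal (G.b x y * φ y) := by
    rw [two_mul_energy, ← ENNReal.tsum_add]
    refine ENNReal.tsum_le_tsum fun x => ?_
    rw [← ENNReal.tsum_add]
    refine ENNReal.tsum_le_tsum fun y => ?_
    rw [← ENNReal.ofReal_add (mul_nonneg (G.nonneg x y) (hφ x).1)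
      (mul_nonneg (G.nonneg x y) (hφ y).1), ← mul_add]
    refine ENNReal.ofReal_le_ofReal (mul_le_mul_of_nonneg_left ?_ (G.nonneg x y))
    nlinarith [hφ x, hφ y, mul_nonneg (hφ x).1 (hφ y).1, mul_nonneg (hφ x).1 (sub_nonneg.2 (hφ x).2),
      mul_nonneg (hφ y).1 (sub_nonneg.2 (hφ y).2)]
  rw [h2] at h3
  refine lt_of_le_of_lt (le_mul_of_one_le_left' one_le_two) (h3.trans_lt ?_)
  exact ENNReal.add_lt_top.2 ⟨h1.lt_top, h1.lt_top⟩

/-- A maximum principle for functions orthogonal to the finitely supported ones, that is for weak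
solutions of `(L + 1) w = 0`: every vertex with `w > 0` has a neighbor where `w` is larger. -/
theorem exists_adj_lt_of_mem_orthogonal (G : WGraph X) {m : X → ℝ} (hm : ∀ x, 0 < m x)
    {w : X → ℝ} {v : lp (fun _ : X ⊕ X × X => ℝ) 2}
    (hv : (v : X ⊕ X × X → ℝ) = G.formCoord m w) (horth : v ∈ (G.finiteSupportSubmodule m)ᗮ)
    {z : X} (hz : 0 < w z) : ∃ y, G.graph.Adj z y ∧ w z < w y := by
  classical
  by_contra! hmax
  have hmax' : ∀ y, 0 < G.b z y → w y ≤ w z := hmax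
  let φ : X → ℝ := Pi.single z 1
  let T : lp (fun _ : X ⊕ X × X => ℝ) 2 :=
    ⟨G.formCoord m φ, G.memℓp_formCoord hm (G.single_mem_maxFormDomain m z)⟩
  have hT : T ∈ G.finiteSupportSubmodule m :=
    ⟨φ, (Set.finite_singleton z).subset Pi.support_single_subset, rfl⟩
  have hsum : HasSum (fun i => G.formCoord m w i * G.formCoord m φ i) 0 := by
    have := lp.hasSum_inner (𝕜 := ℝ) T v
    rw [Submodule.inner_right_of_mem_orthogonal hT horth, hv] at this
    exact this
  have hnonneg : ∀ i, 0 ≤ G.formCoord m w i * G.formCoord m φ i := by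
    intro i
    rcases i with x | ⟨x, y⟩
    · by_cases hx : x = z
      · subst hx
        have := hz.le
        simp only [formCoord, Sum.elim_inl, φ, Pi.single_eq_same]
        positivity
      · simp [formCoord, φ, hx]
    · simp only [formCoord, Sum.elim_inr]
      rw [mul_mul_mul_comm]
      rcases (G.nonneg x y).eq_or_lt with hb | hb
      · simp [← hb]
      refine mul_nonneg (mul_self_nonneg _) ?_
      by_cases hx : x = z <;> by_cases hy : y = z
      · simp [hx, hy]
      · subst hx
        simpa [φ, hy] using hmax' y hb
      · subst hy
        rw [G.symm] at hb
        simpa [φ, hx] using hmax' x hb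
      · simp [φ, hx, hy]
  have h0 := (hasSum_zero_iff_of_nonneg hnonneg).1 hsum
  have h1 : G.formCoord m w (.inl z) * G.formCoord m φ (.inl z) = 0 :=
    congrFun h0 (.inl z)
  have hmz := Real.sqrt_pos.2 (hm z)
  simp only [formCoord, Sum.elim_inl, φ, Pi.single_eq_same] at h1
  have : 0 < √(m z) * w z * (√(m z) * 1) := by positivity
  exact this.ne' h1

/-- The maximum principle produces an infinite path along which `w` increases, which is impossible
in `ℓ²` if the path has infinite measure. -/
theorem nonpos_of_mem_orthogonal (G : WGraph X) {m : X → ℝ} (hm : ∀ x, 0 < m x)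
    (hpath : G.InfinitePathsHaveInfiniteMeasure m) {w : X → ℝ}
    {v : lp (fun _ : X ⊕ X × X => ℝ) 2} (hv : (v : X ⊕ X × X → ℝ) = G.formCoord m w)
    (horth : v ∈ (G.finiteSupportSubmodule m)ᗮ) (z : X) : w z ≤ 0 := by
  by_contra! hz
  have step : ∀ p : {x // 0 < w x}, ∃ q : {x // 0 < w x}, G.graph.Adj p.1 q.1 ∧ w p.1 < w q.1 := by
    rintro ⟨x, hx⟩
    obtain ⟨y, hy, hxy⟩ := G.exists_adj_lt_of_mem_orthogonal hm hv horth hx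
    exact ⟨⟨y, hx.trans hxy⟩, hy, hxy⟩
  choose f hadj hlt using step
  let s : ℕ → {x // 0 < w x} := fun n => f^[n] ⟨z, hz⟩
  have hs : ∀ n, s (n + 1) = f (s n) := fun n => Function.iterate_succ_apply' f n _
  have hmono : StrictMono fun n => w (s n).1 :=
    strictMono_nat_of_lt_succ fun n => by simp only [hs]; exact hlt _
  have hinj : Function.Injective fun n => (s n).1 := fun a b hab =>
    hmono.injective (congrArg w hab)
  have htop := hpath _ hinj fun n => by simp only [hs]; exact hadj _
  have hle : ENNReal.ofReal (w z ^ 2) * vol m (Set.range fun n => (s n).1) ≤ normSq m w := by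
    rw [vol_eq_tsum_indicator, normSq, ← ENNReal.tsum_mul_left]
    refine ENNReal.tsum_le_tsum fun x => ?_
    by_cases hx : x ∈ Set.range fun n => (s n).1
    · rw [Set.indicator_of_mem hx, ENNReal.ofReal_mul (sq_nonneg _)]
      obtain ⟨n, rfl⟩ := hx
      have : w z ≤ w (s n).1 := hmono.monotone (Nat.zero_le n)
      gcongr
    · simp [Set.indicator_of_notMem hx]
  rw [htop, ENNReal.mul_top (ENNReal.ofReal_pos.2 (by positivity)).ne', top_le_iff] at hle
  exact (G.normSq_lt_top_of_eq_formCoord hm hv).ne hle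

/-- The component of `u` orthogonal to the finitely supported functions vanishes, since it and its
negative are nonpositive. -/
theorem formDomain_eq_of_infinitePaths (G : WGraph X) {m : X → ℝ} (hm : ∀ x, 0 < m x)
    (hpath : G.InfinitePathsHaveInfiniteMeasure m) : G.formDomain m = G.maxFormDomain m := by
  refine Set.Subset.antisymm (fun u hu => hu.1) fun u hu => ⟨hu, fun ε hε => ?_⟩
  let T : lp (fun _ : X ⊕ X × X => ℝ) 2 := ⟨G.formCoord m u, G.memℓp_formCoord hm hu⟩
  obtain ⟨P, hP, R, hR, hTPR⟩ :=
    (G.finiteSupportSubmodule m).topologicalClosure.exists_add_mem_mem_orthogonal T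
  rw [Submodule.orthogonal_closure] at hR
  obtain ⟨p, hp⟩ := G.exists_eq_formCoord_of_mem_closure hm hP
  have hRw : (R : X ⊕ X × X → ℝ) = G.formCoord m (u - p) := by
    rw [formCoord_sub, ← hp, show R = T - P by rw [hTPR]; abel]; rfl
  have hnRw : ((-R : lp (fun _ : X ⊕ X × X => ℝ) 2) : X ⊕ X × X → ℝ)
      = G.formCoord m (p - u) := by
    rw [lp.coeFn_neg, hRw, formCoord_sub, formCoord_sub, neg_sub]
  have hup : u = p := funext fun x => le_antisymm
    (by simpa using G.nonpos_of_mem_orthogonal hm hpath hRw hR x)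
    (by simpa using G.nonpos_of_mem_orthogonal hm hpath hnRw (neg_mem hR) x)
  subst hup
  have hPT : P = T := lp.ext hp
  rw [hPT] at hP
  obtain ⟨δ, hδ, hδε⟩ : ∃ δ : ℝ, 0 < δ ∧ ENNReal.ofReal (δ ^ 2) < ε := by
    have hlim : Filter.Tendsto (fun δ : ℝ => ENNReal.ofReal (δ ^ 2)) (nhdsWithin 0 (Set.Ioi 0))
        (nhds 0) := by
      have hc : Continuous fun δ : ℝ => ENNReal.ofReal (δ ^ 2) :=
        ENNReal.continuous_ofReal.comp (by fun_prop)
      simpa using (hc.tendsto 0).mono_left (nhdsWithin_le_nhds (s := Set.Ioi 0))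
    obtain ⟨δ, h1, h2⟩ := ((hlim.eventually (gt_mem_nhds hε)).and self_mem_nhdsWithin).exists
    exact ⟨δ, h2, h1⟩
  obtain ⟨V, ⟨φ, hφ, hV⟩, hdist⟩ := Metric.mem_closure_iff.1 hP δ hδ
  refine ⟨φ, hφ, ?_⟩
  have hTV : ((T - V : lp (fun _ : X ⊕ X × X => ℝ) 2) : X ⊕ X × X → ℝ)
      = G.formCoord m (u - φ) := by
    rw [lp.coeFn_sub, hV, formCoord_sub]
  rw [G.energy_add_normSq_eq_norm_sq hm hTV, ← dist_eq_norm]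
  refine lt_of_le_of_lt (ENNReal.ofReal_le_ofReal ?_) hδε
  gcongr

end WGraph

theorem mainTheorem5 {X : Type*} [Countable X] [Infinite X] [PseudoMetricSpace X]
    (m : X → ℝ) (hm : ∀ x, 0 < m x) (G : WGraph X) (hd : G.IsIntrinsic m) :
    (G.formDomain m = G.maxFormDomain m →
      2 * (G.cheegerConst m : EReal) ≤ WGraph.volumeGrowth m) ∧
    (G.IsLocallyFinite → G.IsPathMetric → CompleteSpace X →
      G.formDomain m = G.maxFormDomain m ∧
        2 * (G.cheegerConst m : EReal) ≤ WGraph.volumeGrowth m) ∧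
    (G.InfinitePathsHaveInfiniteMeasure m →
      G.formDomain m = G.maxFormDomain m ∧
        2 * (G.cheegerConst m : EReal) ≤ WGraph.volumeGrowth m) := by
  have main := hd.two_mul_cheegerConst_le_volumeGrowth hm
  refine ⟨main, fun hG hpath _ => ?_, fun hpath => ?_⟩
  · obtain ⟨o⟩ : Nonempty X := inferInstance
    have hD := hd.formDomain_eq_of_finite_ball hm o (WGraph.finite_ball_of_isPathMetric hG hpath o)
    exact ⟨hD, main hD⟩
  · have hD := G.formDomain_eq_of_infinitePaths hm hpath
    exact ⟨hD, main hD⟩
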